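/- Conventions. A $(v,k,\lambda)$-BIBD, for positive integers $v,k,\lambda$ with $2\le k<v$, is a set of $v$ points with a collection (repetitions allowed) of $k$-element subsets, called blocks, such that any two distinct points lie together in exactly $\lambda$ blocks. It is symmetric if it has exactly $v$ blocks. It is resolvable (an RBIBD) if its blocks can be partitioned into classes such that the blocks of each class are pairwise disjoint and cover the point set. A $0$-ULSE $\ell$-colouring of a $(v,k,\lambda)$-BIBD is a surjective map from its points to a set of $\ell$ colours such that $(\ell-1)\mid k$ and, for every block $B$, some colour does not occur in $B$ while for any two of the other colours the numbers of their occurrences in $B$ differ by at most $1$. Theorem. Let $k,\ell$ be positive integers and suppose that there exists an $$\left(\frac{(\ell-2)k}{(\ell-1)^2-k},\ \frac{k}{\ell-1},\ \frac{(\ell-1)^2-k}{\ell-1}\right)\text{-RBIBD}$$ (in particular, these three numbers are defined and are positive integers). Put $$v=\frac{\ell(\ell-2)k}{(\ell-1)^2-k},\qquad \lambda_{0}=\frac{k\left((\ell-1)^2-k\right)}{(\ell-1)^2}.$$ Then $v$ and $\lambda_0$ are positive integers, there exists a symmetric $(v,k,\lambda_0)$-BIBD that has a $0$-ULSE $\ell$-colouring,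 and for every positive integer multiple $\lambda$ of $\lambda_0$ there exists a $(v,k,\lambda)$-BIBD that has a $0$-ULSE $\ell$-colouring. -/

import Mathlib

/-- The family of blocks `B : ι → Finset V` (repeated blocks are allowed, as several indices can
carry the same block) is a `(v, k, lam)`-BIBD with point set `V`. -/
structure IsBIBD {V ι : Type*} [Fintype V] [DecidableEq V] [Fintype ι]
    (B : ι → Finset V) (v k lam : ℕ) : Prop where
  two_le : 2 ≤ k
  lt : k < v
  lam_pos : 0 < lam
  card_points : Fintype.card V = v
  card_block : ∀ i, (B i).card = k
  card_pair : ∀ x y : V, x ≠ y →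
    (Finset.univ.filter fun i => x ∈ B i ∧ y ∈ B i).card = lam

/-- The blocks can be partitioned into resolution classes `Π_1, …, Π_r`. The class of the block
with index `i` is `c i`; the blocks in each class cover `V` and are pairwise disjoint. -/
def IsResolvable {V ι : Type*} (B : ι → Finset V) : Prop :=
  ∃ (r : ℕ) (c : ι → Fin r), ∀ j : Fin r,
    (∀ x : V, ∃ i, c i = j ∧ x ∈ B i) ∧
    (∀ i₁ i₂, c i₁ = j → c i₂ = j → i₁ ≠ i₂ → Disjoint (B i₁) (B i₂))

/-- `|C_c ∩ S|`, where `C_c` is the colour class of `c` under the colouring `f`. -/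
def colourCount {V : Type*} {l : ℕ} (f : V → Fin l) (S : Finset V) (c : Fin l) : ℕ :=
  (S.filter fun x => f x = c).card

/-- `f` is an `n`-locally semi-equitable `l`-colouring of the family of blocks `B`: it is
surjective, and in each block `B i` some colour is represented exactly `n i` times while the
numbers of occurrences of any two other colours differ by at most one. -/
def IsLSE {V ι : Type*} (B : ι → Finset V) (n : ι → ℕ) {l : ℕ} (f : V → Fin l) : Prop :=
  Function.Surjective f ∧
  ∀ i, ∃ c : Fin l, colourCount f (B i) c = n i ∧
    ∀ c₁ c₂ : Fin l, c₁ ≠ c → c₂ ≠ c →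
      |(colourCount f (B i) c₁ : ℤ) - (colourCount f (B i) c₂ : ℤ)| ≤ 1

/-- Uniform `n`-LSE colouring: `l - 1` divides `k - n i` for every block `B i`, where `k` is the
size of the block. -/
def IsULSE {V ι : Type*} (B : ι → Finset V) (n : ι → ℕ) {l : ℕ} (f : V → Fin l) : Prop :=
  IsLSE B n f ∧ ∀ i, ((l : ℤ) - 1) ∣ (((B i).card : ℤ) - (n i : ℤ))

/-- There is a `t`-ULSE `l`-coloured `(v, k, lam)`-BIBD. -/
def ExistsULSEColouredBIBD (t l v k lam : ℕ) : Prop :=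
  ∃ (V ι : Type) (_ : Fintype V) (_ : DecidableEq V) (_ : Fintype ι) (B : ι → Finset V)
    (f : V → Fin l), IsBIBD B v k lam ∧ IsULSE B (fun _ => t) f

/-- There is a symmetric (as many blocks as points) `t`-ULSE `l`-coloured `(v, k, lam)`-BIBD. -/
def ExistsSymmetricULSEColouredBIBD (t l v k lam : ℕ) : Prop :=
  ∃ (V ι : Type) (_ : Fintype V) (_ : DecidableEq V) (_ : Fintype ι) (B : ι → Finset V)
    (f : V → Fin l), IsBIBD B v k lam ∧ Fintype.card ι = v ∧ IsULSE B (fun _ => t) f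

/-!
Put `m = l - 1`. The numerical hypotheses say `lam₀ + k₀ = m` and `lam₀ v₀ = (m - 1) k₀`, so every
point of the given resolvable design lies in exactly `m` blocks; equivalently, there are `m`
resolution classes. These parameters satisfy Bose's condition `b = v₀ + m - 1`, and the usual
variance argument (`card_mul_card_cell_inter`) shows that the design is affine: blocks of distinct
classes meet in exactly `k₀² / v₀` points.

Wallis's construction then gives the symmetric design. The points are `Fin (m + 1) × V`, with one
copy of `V` for each colour. The `m` classes are labelled by the nonzero elements of `Fin (m + 1)`,
and the block `(i, y)` meets the copy with colour `j` in the class-`(i + j)` block through `y`, which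
is empty when `i + j = 0`. Every block thus misses one colour and contains `k₀` points of every
other. Two points of equal colour lie together in `k₀ lam₀` blocks because `i ↦ i + j` runs through
all the classes; two points of different colours do so because `i + j ≠ i + j'` and the design is
affine. Repeating every block `t` times handles the multiples of `k₀ lam₀`.
-/

open Finset

/-! ### Resolutions as families of labellings -/

/-- The class of `x` in the partition of `V` into the fibres of the labelling `g c`. In a resolvable
design, where `g c` labels each point by the block of class `c` through it, this is that block. -/
def cell {V β C : Type*} [Fintype V] [DecidableEq β] (g : C → V → β) (c : C) (x : V) : Finset V :=
  univ.filter fun y => g c y = g c x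

/-- The family `g` of labellings encodes a resolved design on `V` with block size `k` and index
`lam`: all fibres that occur have `k` elements, and two distinct points have the same label in
exactly `lam` of the classes. -/
structure IsResolvedDesign {V β C : Type*} [Fintype V] [Fintype C] [DecidableEq β]
    (g : C → V → β) (k lam : ℕ) : Prop where
  card_cell : ∀ c x, (cell g c x).card = k
  card_class : ∀ x y, x ≠ y → (univ.filter fun c => g c x = g c y).card = lam

theorem mem_cell {V β C : Type*} [Fintype V] [DecidableEq β] {g : C → V → β} {c : C} {x y : V} :
    y ∈ cell g c x ↔ g c y = g c x := by
  simp [cell]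

/-- A resolvable BIBD on any point set of size `v` yields a resolved design on `Fin v`. -/
theorem exists_isResolvedDesign {V ι : Type*} [Fintype V] [DecidableEq V] [Fintype ι]
    {A : ι → Finset V} {v k lam : ℕ} (hA : IsBIBD A v k lam) (hres : IsResolvable A) :
    ∃ (r : ℕ) (g : Fin r → Fin v → Fin (Fintype.card ι)), IsResolvedDesign g k lam := by
  classical
  obtain ⟨r, c, hc⟩ := hres
  choose b hb hxb using fun j => (hc j).1
  have huniq : ∀ j x i, c i = j → x ∈ A i → i = b j x := by
    intro j x i hi hx
    by_contra hne
    exact (Finset.disjoint_left.mp ((hc j).2 i (b j x) hi (hb j x) hne)) hx (hxb j x)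
  have hmem : ∀ j x y, b j y = b j x ↔ y ∈ A (b j x) := fun j x y =>
    ⟨fun h => h ▸ hxb j y, fun h => (huniq j y _ (hb j x) h).symm⟩
  let e : V ≃ Fin v := Fintype.equivFinOfCardEq hA.card_points
  let eι : ι ≃ Fin (Fintype.card ι) := Fintype.equivFin ι
  refine ⟨r, fun j x => eι (b j (e.symm x)), ?_, ?_⟩
  · intro j x
    rw [← hA.card_block (b j (e.symm x)), ← Finset.card_map e.toEmbedding]
    congr 1
    ext y
    simp [mem_cell, hmem, Finset.mem_map_equiv]
  · intro x y hxy
    rw [← hA.card_pair (e.symm x) (e.symm y) (fun h => hxy (e.symm.injective h))]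
    refine Finset.card_bij (fun j _ => b j (e.symm x)) ?_ ?_ ?_
    · intro j hj
      have hj' : b j (e.symm x) = b j (e.symm y) := by simpa using hj
      simp only [Finset.mem_filter, Finset.mem_univ, true_and]
      exact ⟨hxb _ _, hj' ▸ hxb _ _⟩
    · intro j₁ _ j₂ _ h
      rw [← hb j₁ (e.symm x), ← hb j₂ (e.symm x), h]
    · intro i hi
      simp only [Finset.mem_filter, Finset.mem_univ, true_and] at hi
      have h1 := huniq (c i) _ i rfl hi.1
      have h2 := huniq (c i) _ i rfl hi.2
      refine ⟨c i, ?_, h1.symm⟩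
      simp [← h1, ← h2]

namespace IsResolvedDesign

variable {V β : Type*} [Fintype V] [DecidableEq β] {r k lam : ℕ} {g : Fin r → V → β}

/-- The pairs `(c, y)` with `y` in the class-`c` block through a fixed point, counted in two
ways. -/
theorem classes_mul_card [DecidableEq V] (h : IsResolvedDesign g k lam) (x : V) :
    r * k = r + (Fintype.card V - 1) * lam := by
  have h1 : ∑ c : Fin r, (cell g c x).card = r * k := by simp [h.card_cell]
  have h2 : ∑ c : Fin r, (cell g c x).card
      = ∑ y : V, (univ.filter fun c => g c y = g c x).card := by
    simp only [cell, Finset.card_filter]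
    exact Finset.sum_comm
  rw [← h1, h2, ← Finset.add_sum_erase _ _ (Finset.mem_univ x)]
  rw [Finset.sum_congr rfl fun y hy => h.card_class y x (Finset.ne_of_mem_erase hy)]
  simp

/-! ### Intersections of blocks from distinct classes -/

theorem sum_card_cell_inter [DecidableEq V] (h : IsResolvedDesign g k lam) (c : Fin r)
    (S : Finset V) : ∑ y, ((cell g c y ∩ S).card : ℤ) = k * S.card := by
  have h1 : ∀ y, ((cell g c y ∩ S).card : ℤ) = ∑ z ∈ S, if g c y = g c z then 1 else 0 := by
    intro y
    rw [Finset.sum_boole, Finset.inter_comm, ← Finset.filter_mem_eq_inter]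
    simp only [mem_cell, eq_comm]
  have h2 : ∀ z, ∑ y, (if g c y = g c z then (1 : ℤ) else 0) = k := by
    intro z
    rw [Finset.sum_boole, ← h.card_cell c z, cell]
  simp_rw [h1]
  rw [Finset.sum_comm]
  simp [h2, mul_comm]

theorem sum_card_cell_inter_sq [DecidableEq V] (h : IsResolvedDesign g k lam) (c : Fin r)
    (S : Finset V) : ∑ y, ((cell g c y ∩ S).card : ℤ) ^ 2
      = k * ∑ z ∈ S, ∑ w ∈ S, if g c z = g c w then 1 else 0 := by
  have h1 : ∀ y, ((cell g c y ∩ S).card : ℤ) = ∑ z ∈ S, if g c y = g c z then 1 else 0 := by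
    intro y
    rw [Finset.sum_boole, Finset.inter_comm, ← Finset.filter_mem_eq_inter]
    simp only [mem_cell, eq_comm]
  have h2 : ∀ z w, ∑ y, ((if g c y = g c z then (1 : ℤ) else 0) * if g c y = g c w then 1 else 0)
      = k * if g c z = g c w then 1 else 0 := by
    intro z w
    by_cases hzw : g c z = g c w
    · simp only [hzw, if_true, mul_one, ← ite_and, mul_ite, mul_zero, and_self]
      rw [Finset.sum_boole, ← h.card_cell c w, cell]
    · rw [if_neg hzw, mul_zero]
      refine Finset.sum_eq_zero fun y _ => ?_
      by_cases hy : g c y = g c z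
      · rw [if_neg fun hw => hzw (hy.symm.trans hw), mul_zero]
      · rw [if_neg hy, zero_mul]
  simp_rw [h1, sq, Finset.sum_mul_sum]
  rw [Finset.sum_comm, Finset.mul_sum]
  refine Finset.sum_congr rfl fun z _ => ?_
  rw [Finset.sum_comm, Finset.mul_sum]
  exact Finset.sum_congr rfl fun w _ => h2 z w

/-- A resolved design whose parameters satisfy Bose's equality is affine. The numbers
`v * |B ∩ S| - k²`, for a fixed block `S` and `B` ranging over the blocks outside its class, have
vanishing sum of squares. -/
theorem card_mul_card_cell_inter [DecidableEq V] (h : IsResolvedDesign g k lam)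
    (hsum : lam + k = r) (hmul : lam * Fintype.card V + k = r * k)
    {c₀ c : Fin r} (hc : c₀ ≠ c) (x y : V) :
    Fintype.card V * (cell g c y ∩ cell g c₀ x).card = k ^ 2 := by
  set v := Fintype.card V with hv
  set S := cell g c₀ x with hS
  have hScard : S.card = k := h.card_cell c₀ x
  -- The second moment over all the classes; the class of `S` contributes `k³`.
  have hall : ∑ c, ∑ y, ((cell g c y ∩ S).card : ℤ) ^ 2 = k * (k * (r + (k - 1) * lam)) := by
    simp_rw [h.sum_card_cell_inter_sq, ← Finset.mul_sum]
    congr 1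
    rw [Finset.sum_comm]
    have : ∀ z ∈ S, ∑ c, ∑ w ∈ S, (if g c z = g c w then (1 : ℤ) else 0)
        = r + (k - 1) * lam := by
      intro z hz
      rw [Finset.sum_comm, ← Finset.add_sum_erase _ _ hz]
      have h3 : ∀ w ∈ S.erase z, ∑ c, (if g c z = g c w then (1 : ℤ) else 0) = lam := by
        intro w hw
        rw [Finset.sum_boole, h.card_class z w (Finset.ne_of_mem_erase hw).symm]
      rw [Finset.sum_congr rfl h3]
      have hk : 1 ≤ k := hScard ▸ Finset.card_pos.mpr ⟨z, hz⟩
      simp [Finset.card_erase_of_mem hz, hScard, Nat.cast_sub hk]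
    rw [Finset.sum_congr rfl this]
    simp [hScard]
  have hown : ∑ y, ((cell g c₀ y ∩ S).card : ℤ) ^ 2 = k * (k * k) := by
    rw [h.sum_card_cell_inter_sq]
    have : ∀ z ∈ S, ∀ w ∈ S, (if g c₀ z = g c₀ w then (1 : ℤ) else 0) = 1 := by
      intro z hz w hw
      rw [if_pos ((mem_cell.mp hz).trans (mem_cell.mp hw).symm)]
    rw [Finset.sum_congr rfl fun z hz => Finset.sum_congr rfl (this z hz)]
    simp [hScard]
  have hrest := Finset.add_sum_erase univ
    (fun c => ∑ y, ((cell g c y ∩ S).card : ℤ) ^ 2) (Finset.mem_univ c₀)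
  simp only [hown, hall] at hrest
  have hr : 1 ≤ r := Nat.one_le_of_lt c₀.pos
  have hvar : ∑ c ∈ univ.erase c₀, ∑ y, ((v : ℤ) * (cell g c y ∩ S).card - k ^ 2) ^ 2 = 0 := by
    have hexp : ∀ c, ∑ y, ((v : ℤ) * (cell g c y ∩ S).card - k ^ 2) ^ 2
        = v ^ 2 * ∑ y, ((cell g c y ∩ S).card : ℤ) ^ 2 - v * k ^ 4 := by
      intro c
      have h4 : ∀ y, ((v : ℤ) * (cell g c y ∩ S).card - k ^ 2) ^ 2
          = v ^ 2 * ((cell g c y ∩ S).card : ℤ) ^ 2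
            - 2 * v * k ^ 2 * (cell g c y ∩ S).card + k ^ 4 := fun y => by ring
      simp_rw [h4]
      rw [Finset.sum_add_distrib, Finset.sum_sub_distrib, ← Finset.mul_sum, ← Finset.mul_sum,
        h.sum_card_cell_inter, hScard]
      simp only [Finset.sum_const, Finset.card_univ, ← hv, nsmul_eq_mul]
      ring
    simp_rw [hexp]
    rw [Finset.sum_sub_distrib, ← Finset.mul_sum, Finset.sum_const,
      Finset.card_erase_of_mem (Finset.mem_univ _), Finset.card_univ, Fintype.card_fin,
      nsmul_eq_mul, Nat.cast_sub hr]
    have e1 : (lam : ℤ) + k = r := by exact_mod_cast hsum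
    have e2 : (lam : ℤ) * v + k = r * k := by exact_mod_cast hmul
    push_cast
    linear_combination (v : ℤ) ^ 2 * hrest + (v : ℤ) * k ^ 3 * e2
      - (v : ℤ) ^ 2 * k ^ 2 * e1
  have hz := (Finset.sum_eq_zero_iff_of_nonneg fun c _ =>
    Finset.sum_nonneg fun y _ => sq_nonneg _).mp hvar c
      (Finset.mem_erase.mpr ⟨hc.symm, Finset.mem_univ _⟩)
  have hz' := (Finset.sum_eq_zero_iff_of_nonneg fun y _ => sq_nonneg _).mp hz y
    (Finset.mem_univ _)
  have := sub_eq_zero.mp (pow_eq_zero_iff (two_ne_zero)|>.mp hz')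
  exact_mod_cast this

end IsResolvedDesign

/-! ### Wallis's construction -/

/-- The blocks of the classes, labelled by the nonzero elements of `Fin (r + 1)`; the label `0` gets
the empty set. -/
def extCell {V β : Type*} [Fintype V] [DecidableEq β] {r : ℕ} (g : Fin r → V → β)
    (a : Fin (r + 1)) (x : V) : Finset V :=
  Fin.cases (motive := fun _ => Finset V) ∅ (fun c => cell g c x) a

/-- The block `(i, y)` of Wallis's design, on the point set `Fin (r + 1) × V`. The Latin square
employed is the addition table of `Fin (r + 1)`. -/
def wallisBlock {V β : Type*} [Fintype V] [DecidableEq V] [DecidableEq β] {r : ℕ}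
    (g : Fin r → V → β) (i : Fin (r + 1) × V) : Finset (Fin (r + 1) × V) :=
  univ.filter fun p => p.2 ∈ extCell g (i.1 + p.1) i.2

section Wallis

variable {V β : Type*} [Fintype V] [DecidableEq β] {r k lam : ℕ}
  {g : Fin r → V → β}

@[simp]
theorem extCell_zero (x : V) : extCell g 0 x = ∅ := rfl

@[simp]
theorem extCell_succ (c : Fin r) (x : V) : extCell g c.succ x = cell g c x := rfl

theorem mem_extCell_comm {a : Fin (r + 1)} {x y : V} :
    x ∈ extCell g a y ↔ y ∈ extCell g a x := by
  cases a using Fin.cases with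
  | zero => simp
  | succ c => simp [mem_cell, eq_comm]

theorem IsResolvedDesign.card_extCell (h : IsResolvedDesign g k lam) (a : Fin (r + 1)) (x : V) :
    (extCell g a x).card = if a = 0 then 0 else k := by
  cases a using Fin.cases with
  | zero => simp
  | succ c => simp [h.card_cell, Fin.succ_ne_zero]

variable [DecidableEq V]

theorem colourCount_wallisBlock (i : Fin (r + 1) × V) (j : Fin (r + 1)) :
    colourCount Prod.fst (wallisBlock g i) j = (extCell g (i.1 + j) i.2).card := by
  unfold colourCount
  rw [← Finset.card_map (Function.Embedding.sectR j V)]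
  congr 1
  ext ⟨j', x⟩
  simp only [wallisBlock, Finset.mem_filter, Finset.mem_univ, true_and, Finset.mem_map,
    Function.Embedding.sectR_apply, Prod.mk.injEq]
  constructor
  · rintro ⟨h, rfl⟩
    exact ⟨x, h, rfl, rfl⟩
  · rintro ⟨x, h, rfl, rfl⟩
    exact ⟨h, rfl⟩

theorem IsResolvedDesign.card_wallisBlock (h : IsResolvedDesign g k lam) (i : Fin (r + 1) × V) :
    (wallisBlock g i).card = r * k := by
  rw [Finset.card_eq_sum_card_fiberwise (f := Prod.fst) (t := univ) (fun _ _ => by simp)]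
  change ∑ j, colourCount Prod.fst (wallisBlock g i) j = _
  simp_rw [colourCount_wallisBlock]
  refine (Equiv.sum_comp (Equiv.addLeft i.1) fun a => (extCell g a i.2).card).trans ?_
  rw [Fin.sum_univ_succ]
  simp [h.card_cell]

/-- Since `y` lies in the class-`a` block through `x` exactly when `x` lies in the one through `y`,
the blocks `(i, y)` containing two given points correspond, for each `i`, to the points `y` of an
intersection of two blocks of the resolved design. -/
theorem card_wallisBlock_pair (p q : Fin (r + 1) × V) :
    (univ.filter fun i => p ∈ wallisBlock g i ∧ q ∈ wallisBlock g i).card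
      = ∑ i, (extCell g (i + p.1) p.2 ∩ extCell g (i + q.1) q.2).card := by
  rw [Finset.card_filter, Fintype.sum_prod_type]
  refine Finset.sum_congr rfl fun i _ => ?_
  rw [← Finset.card_filter]
  congr 1
  ext y
  simp [wallisBlock, mem_extCell_comm (y := y)]

theorem IsResolvedDesign.sum_card_cell_inter_cell (h : IsResolvedDesign g k lam) {x y : V}
    (hxy : x ≠ y) : ∑ c, (cell g c x ∩ cell g c y).card = k * lam := by
  have h1 : ∀ c, (cell g c x ∩ cell g c y).card = if g c x = g c y then k else 0 := by
    intro c
    split_ifs with hc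
    · rw [show cell g c x = cell g c y by simp [cell, hc], Finset.inter_self, h.card_cell]
    · rw [Finset.card_eq_zero, ← Finset.disjoint_iff_inter_eq_empty, Finset.disjoint_left]
      intro z hz hz'
      exact hc ((mem_cell.mp hz).symm.trans (mem_cell.mp hz'))
  simp_rw [h1]
  rw [← Finset.sum_filter, Finset.sum_const, h.card_class x y hxy, smul_eq_mul, mul_comm]

theorem IsResolvedDesign.isBIBD_wallisBlock (h : IsResolvedDesign g k lam)
    (hk : 2 ≤ k) (hkv : k < Fintype.card V) (hlam : 0 < lam)
    (hsum : lam + k = r) (hmul : lam * Fintype.card V + k = r * k) :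
    IsBIBD (wallisBlock g) ((r + 1) * Fintype.card V) (r * k) (k * lam) where
  two_le := by nlinarith
  lt := by nlinarith
  lam_pos := by positivity
  card_points := by simp
  card_block := h.card_wallisBlock
  card_pair := by
    rintro ⟨j, x⟩ ⟨j', x'⟩ hne
    rw [card_wallisBlock_pair]
    by_cases hj : j = j'
    · subst hj
      have hx : x ≠ x' := fun hx => hne (by rw [hx])
      refine (Equiv.sum_comp (Equiv.addRight j) fun a =>
        (extCell g a x ∩ extCell g a x').card).trans ?_
      rw [Fin.sum_univ_succ]
      simp [h.sum_card_cell_inter_cell hx]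
    · -- Exactly two labels `i` contribute nothing, and each of the others contributes `k² / v`.
      have hterm : ∀ i, Fintype.card V * (extCell g (i + j) x ∩ extCell g (i + j') x').card
          = if i ∈ ({-j, -j'} : Finset (Fin (r + 1)))ᶜ then k ^ 2 else 0 := by
        intro i
        have hij : i + j ≠ i + j' := fun hi => hj (add_left_cancel hi)
        simp only [Finset.mem_compl, Finset.mem_insert, Finset.mem_singleton,
          ← add_eq_zero_iff_eq_neg]
        generalize i + j = a at hij ⊢
        generalize i + j' = a' at hij ⊢
        cases a using Fin.cases with
        | zero => simp
        | succ c =>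
          cases a' using Fin.cases with
          | zero => simp
          | succ c' =>
            have hcc : c' ≠ c := fun hc => hij (by rw [hc])
            simp [h.card_mul_card_cell_inter hsum hmul hcc, Fin.succ_ne_zero]
      have hcard : (({-j, -j'} : Finset (Fin (r + 1)))ᶜ).card = r - 1 := by
        rw [Finset.card_compl, Finset.card_pair (fun hn => hj (neg_injective hn)),
          Fintype.card_fin]
        omega
      have hV : 0 < Fintype.card V := by omega
      refine Nat.eq_of_mul_eq_mul_left hV ?_
      rw [Finset.mul_sum]
      simp_rw [hterm]
      rw [Finset.sum_ite_mem, Finset.univ_inter, Finset.sum_const, hcard, smul_eq_mul]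
      obtain ⟨s, rfl⟩ : ∃ s, r = s + 1 := ⟨r - 1, by omega⟩
      rw [Nat.add_sub_cancel]
      have : lam * Fintype.card V = s * k := by linarith
      rw [mul_left_comm, mul_comm (Fintype.card V), this]
      ring

theorem IsResolvedDesign.isULSE_wallisBlock [Nonempty V] (h : IsResolvedDesign g k lam) :
    IsULSE (wallisBlock g) (fun _ => 0) (Prod.fst : Fin (r + 1) × V → Fin (r + 1)) := by
  refine ⟨⟨Prod.fst_surjective, fun i => ⟨-i.1, ?_, fun c₁ c₂ h₁ h₂ => ?_⟩⟩, fun i => ?_⟩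
  · simp [colourCount_wallisBlock]
  · have hne : ∀ c, c ≠ -i.1 → i.1 + c ≠ 0 := fun c hc h0 => hc (eq_neg_of_add_eq_zero_right h0)
    simp [colourCount_wallisBlock, h.card_extCell, hne c₁ h₁, hne c₂ h₂]
  · simp [h.card_wallisBlock]

end Wallis

/-! ### Repeated blocks -/

theorem IsBIBD.repeat {V ι : Type*} [Fintype V] [DecidableEq V] [Fintype ι] {B : ι → Finset V}
    {v k lam t : ℕ} (hB : IsBIBD B v k lam) (ht : 0 < t) :
    IsBIBD (fun i : ι × Fin t => B i.1) v k (lam * t) where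
  two_le := hB.two_le
  lt := hB.lt
  lam_pos := Nat.mul_pos hB.lam_pos ht
  card_points := hB.card_points
  card_block i := hB.card_block i.1
  card_pair x y hxy := by
    rw [← hB.card_pair x y hxy, Finset.card_filter, Fintype.sum_prod_type, Finset.card_filter,
      Finset.sum_mul]
    refine Finset.sum_congr rfl fun i _ => ?_
    split_ifs <;> simp

theorem IsULSE.comp {V ι κ : Type*} {B : ι → Finset V} {n : ι → ℕ} {l : ℕ} {f : V → Fin l}
    (h : IsULSE B n f) (u : κ → ι) : IsULSE (fun i => B (u i)) (fun i => n (u i)) f :=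
  ⟨⟨h.1.1, fun i => h.1.2 (u i)⟩, fun i => h.2 (u i)⟩

theorem mainTheorem9 (k l v₀ k₀ lam₀ : ℕ)
    (hv₀ : (v₀ : ℚ) = ((l : ℚ) - 2) * k / (((l : ℚ) - 1) ^ 2 - k))
    (hk₀ : (k₀ : ℚ) = (k : ℚ) / ((l : ℚ) - 1))
    (hlam₀ : (lam₀ : ℚ) = (((l : ℚ) - 1) ^ 2 - k) / ((l : ℚ) - 1))
    {V ι : Type*} [Fintype V] [DecidableEq V] [Fintype ι] (A : ι → Finset V)
    (hA : IsBIBD A v₀ k₀ lam₀) (hres : IsResolvable A) :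
    ∃ v lamMin : ℕ,
      (v : ℚ) = (l : ℚ) * ((l : ℚ) - 2) * k / (((l : ℚ) - 1) ^ 2 - k) ∧
      (lamMin : ℚ) = (k : ℚ) * (((l : ℚ) - 1) ^ 2 - k) / ((l : ℚ) - 1) ^ 2 ∧
      ExistsSymmetricULSEColouredBIBD 0 l v k lamMin ∧
      ∀ lam : ℕ, 0 < lam → lamMin ∣ lam → ExistsULSEColouredBIBD 0 l v k lam 
    := by
  have hk2 := hA.two_le
  have hkv := hA.lt
  have hlam := hA.lam_pos
  have hk0 : (k₀ : ℚ) ≠ 0 := by positivity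
  have hv0 : (v₀ : ℚ) ≠ 0 := by
    have : 0 < v₀ := by omega
    positivity
  -- Both denominators are nonzero, since a quotient by zero would be zero.
  have hl1 : (l : ℚ) - 1 ≠ 0 := fun h => hk0 (by rw [hk₀, h, div_zero])
  have hd : ((l : ℚ) - 1) ^ 2 - k ≠ 0 := fun h => hv0 (by rw [hv₀, h, div_zero])
  have hlpos : 0 < l := by
    rcases Nat.eq_zero_or_pos l with rfl | h
    · have h1 : (0 : ℚ) ≤ k := Nat.cast_nonneg k
      have h2 : (0 : ℚ) < k₀ := by positivity
      rw [hk₀] at h2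
      norm_num at h2
      linarith
    · exact h
  obtain ⟨m, rfl⟩ : ∃ m, l = m + 1 := ⟨l - 1, by omega⟩
  have hm : ((m + 1 : ℕ) : ℚ) - 1 = m := by push_cast; ring
  have hm2 : ((m + 1 : ℕ) : ℚ) - 2 = m - 1 := by push_cast; ring
  rw [hm] at hk₀ hlam₀ hl1 hd hv₀
  rw [hm2] at hv₀
  have ek : (k : ℚ) = m * k₀ := by rw [hk₀]; field_simp
  have elam : (lam₀ : ℚ) = m - k₀ := by rw [hlam₀, ek]; field_simp
  have hsum : lam₀ + k₀ = m := by
    have : (lam₀ : ℚ) + k₀ = m := by rw [elam]; ring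
    exact_mod_cast this
  have hmul : lam₀ * v₀ + k₀ = m * k₀ := by
    have h1 : (v₀ : ℚ) * (m ^ 2 - k) = (m - 1) * k := by rw [hv₀]; field_simp
    have h2 : (lam₀ : ℚ) * v₀ + k₀ = m * k₀ := by
      refine mul_left_cancel₀ hl1 ?_
      rw [ek] at h1
      rw [elam]
      linear_combination h1
    exact_mod_cast h2
  have hkm : k = m * k₀ := by exact_mod_cast ek
  obtain ⟨r, g, hg⟩ := exists_isResolvedDesign hA hres
  have hr : r = m := by
    have h1 := hg.classes_mul_card ⟨0, by omega⟩
    rw [Fintype.card_fin] at h1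
    obtain ⟨w, rfl⟩ : ∃ w, v₀ = w + 1 := ⟨v₀ - 1, by omega⟩
    obtain ⟨q, rfl⟩ : ∃ q, k₀ = q + 1 := ⟨k₀ - 1, by omega⟩
    rw [Nat.add_sub_cancel] at h1
    have hq : 0 < q := by omega
    refine Nat.eq_of_mul_eq_mul_right hq ?_
    linarith
  subst hr
  have : Nonempty (Fin v₀) := ⟨⟨0, by omega⟩⟩
  have hB := hg.isBIBD_wallisBlock hk2 (by simpa using hkv) hlam hsum (by simpa using hmul)
  have hU := hg.isULSE_wallisBlock
  rw [Fintype.card_fin, ← hkm] at hB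
  refine ⟨(r + 1) * v₀, k₀ * lam₀, ?_, ?_,
    ⟨_, _, _, _, _, _, _, hB, by simp, hU⟩, ?_⟩
  · rw [hm, hm2, Nat.cast_mul, hv₀]
    ring
  · rw [hm, Nat.cast_mul, hlam₀, hk₀]
    ring
  · rintro _ hpos ⟨t, rfl⟩
    exact ⟨_, _, _, _, _, _, _, hB.repeat (Nat.pos_of_mul_pos_left hpos), hU.comp Prod.fst⟩
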